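/- Let $\Gamma$ be an abelian group and let $R=\bigoplus_{\gamma\in\Gamma}R_\gamma$ be a $\Gamma$-graded associative ring, not necessarily unital. A graded left ideal is a left ideal $I$ with $I=\bigoplus_\gamma (I\cap R_\gamma)$, and graded submodules of graded modules are defined in the same way. Terminology. - A graded module is *graded artinian* if every descending chain of graded submodules is eventually constant. The ring $R$ is *graded left artinian* if it is graded artinian as a left module over itself, and *graded artinian* if it is graded left artinian and graded right artinian. - $R$ is *graded locally left artinian* if for every finite set $F$ of homogeneous elements there is a homogeneous idempotent $e$ such that $F\subseteq eRe$ and the graded ring $eRe$ is graded left artinian; it is *graded locally artinian* if this and its right-sided analogue hold. - $R$ is *graded categorically left artinian* if every finitely generated unitary graded left $R$-module $M$ (unitary means $RM=M$) is graded artinian; it is *graded categorically artinian* if this and its right-sided analogue hold. - $R$ is *graded regular* if $x\in xRx$ for every homogeneous $x\in R$. - $R$ is *graded semiprime* if it has no nonzero nilpotent graded two-sided ideals, and *graded semisimple* if it is graded semiprime and is a direct sum of minimal (nonzero) graded left ideals. Then the following hold. 1. If $R$ is graded semisimple, then $R$ is graded categorically artinian. 2. If $R$ is unital, graded regular and graded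 artinian, then $R$ is graded semisimple. 3. If $R$ is graded regular and graded locally artinian, then $R$ is graded semisimple. -/

import Mathlib

universe u v w

namespace GradedNonUnital

/-- `R` is a `Γ`-graded ring with components `𝒜 γ`. The ring need not be unital. -/
structure IsGradedRing {Γ : Type v} {R : Type u} [AddCommGroup Γ] [DecidableEq Γ]
    [NonUnitalRing R] (𝒜 : Γ → AddSubgroup R) : Prop where
  isInternal : DirectSum.IsInternal 𝒜
  mul_mem : ∀ ⦃γ δ : Γ⦄ ⦃r s : R⦄, r ∈ 𝒜 γ → s ∈ 𝒜 δ → r * s ∈ 𝒜 (γ + δ)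

/-- Left modules over a ring which need not be unital. -/
class LeftModule (R : Type u) (M : Type w) [NonUnitalRing R] [AddCommGroup M]
    extends SMul R M where
  smul_add : ∀ (r : R) (m n : M), r • (m + n) = r • m + r • n
  add_smul : ∀ (r s : R) (m : M), (r + s) • m = r • m + s • m
  mul_smul : ∀ (r s : R) (m : M), (r * s) • m = r • (s • m)

/-- A ring is a left module over itself. -/
instance LeftModule.self (R : Type u) [NonUnitalRing R] : LeftModule R R where
  smul := fun r m => r * m
  smul_add := mul_add
  add_smul := add_mul
  mul_smul := mul_assoc

section Modules

variable {Γ : Type v} (R : Type u) {M : Type w} [AddCommGroup Γ] [NonUnitalRing R]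
  [AddCommGroup M] [LeftModule R M]

/-- `M` is a graded left `R`-module with components `ℳ γ`. -/
structure IsGradedModule [DecidableEq Γ] {R : Type u} [NonUnitalRing R] [LeftModule R M]
    (𝒜 : Γ → AddSubgroup R) (ℳ : Γ → AddSubgroup M) : Prop where
  isInternal : DirectSum.IsInternal ℳ
  smul_mem : ∀ ⦃γ δ : Γ⦄ ⦃r : R⦄ ⦃m : M⦄, r ∈ 𝒜 γ → m ∈ ℳ δ → r • m ∈ ℳ (γ + δ)

/-- The additive subgroup `N` is an `R`-submodule. -/
def IsSubmodule (N : AddSubgroup M) : Prop :=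
  ∀ (r : R) ⦃m : M⦄, m ∈ N → r • m ∈ N

/-- The additive subgroup `N` is the sum of its intersections with the components. (The sum is
direct, since the components are independent.) -/
def IsHomogeneousSubgroup (ℳ : Γ → AddSubgroup M) (N : AddSubgroup M) : Prop :=
  N = ⨆ γ, N ⊓ ℳ γ

/-- `N` is a graded `R`-submodule. -/
def IsGradedSubmodule (ℳ : Γ → AddSubgroup M) (N : AddSubgroup M) : Prop :=
  IsSubmodule R N ∧ IsHomogeneousSubgroup ℳ N

/-- Every descending chain of graded submodules is eventually constant. -/
def IsGradedArtinianModule (ℳ : Γ → AddSubgroup M) : Prop :=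
  ∀ N : ℕ → AddSubgroup M, (∀ n, IsGradedSubmodule R ℳ (N n)) → Antitone N →
    ∃ n, ∀ m, n ≤ m → N m = N n

variable (M) in
/-- `M` is finitely generated: no proper submodule contains some finite subset of `M`. -/
def IsFinitelyGenerated : Prop :=
  ∃ s : Finset M, ∀ N : AddSubgroup M, IsSubmodule R N → (∀ m ∈ s, m ∈ N) → N = ⊤

variable (M) in
/-- `M` is unitary: `R M = M`. -/
def IsUnitary : Prop :=
  AddSubgroup.closure {y : M | ∃ (r : R) (m : M), y = r • m} = ⊤

end Modules

section Rings

variable {Γ : Type v} {R : Type u} [AddCommGroup Γ] [NonUnitalRing R]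

/-- The opposite ring with the same homogeneous components. Right modules and right ideals
of `R` are left modules and left ideals of the opposite ring. -/
def opGrading (𝒜 : Γ → AddSubgroup R) (γ : Γ) : AddSubgroup Rᵐᵒᵖ :=
  (𝒜 γ).map (MulOpposite.opAddEquiv : R ≃+ Rᵐᵒᵖ).toAddMonoidHom

/-- `I` is a graded left ideal. -/
def IsGradedLeftIdeal (𝒜 : Γ → AddSubgroup R) (I : AddSubgroup R) : Prop :=
  IsGradedSubmodule R 𝒜 I

/-- `I` is a graded two-sided ideal. -/
def IsGradedIdeal (𝒜 : Γ → AddSubgroup R) (I : AddSubgroup R) : Prop :=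
  (∀ (r : R) ⦃a : R⦄, a ∈ I → r * a ∈ I ∧ a * r ∈ I) ∧ IsHomogeneousSubgroup 𝒜 I

/-- `powSucc I n` is the power `I ^ (n + 1)`, the additive subgroup generated by all products
of `n + 1` elements of `I`. -/
def powSucc (I : AddSubgroup R) : ℕ → AddSubgroup R
  | 0 => I
  | n + 1 => AddSubgroup.closure {y : R | ∃ a ∈ powSucc I n, ∃ b ∈ I, y = a * b}

/-- `R` has no nonzero nilpotent graded ideals. -/
def IsGradedSemiprime (𝒜 : Γ → AddSubgroup R) : Prop :=
  ∀ I : AddSubgroup R, IsGradedIdeal 𝒜 I → (∃ n, powSucc I n = ⊥) → I = ⊥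

/-- `I` is minimal among the nonzero graded left ideals. -/
def IsMinimalGradedLeftIdeal (𝒜 : Γ → AddSubgroup R) (I : AddSubgroup R) : Prop :=
  IsGradedLeftIdeal 𝒜 I ∧ I ≠ ⊥ ∧
    ∀ J : AddSubgroup R, IsGradedLeftIdeal 𝒜 J → J ≤ I → J = ⊥ ∨ J = I

/-- `R` is graded semiprime and it is the direct sum of a family of minimal graded left
ideals. -/
def IsGradedSemisimple (𝒜 : Γ → AddSubgroup R) : Prop :=
  IsGradedSemiprime 𝒜 ∧
    ∃ S : Set (AddSubgroup R), (∀ I ∈ S, IsMinimalGradedLeftIdeal 𝒜 I) ∧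
      sSupIndep S ∧ sSup S = ⊤

/-- `x ∈ x R x` for every homogeneous `x`. -/
def IsGradedRegular (𝒜 : Γ → AddSubgroup R) : Prop :=
  ∀ x : R, SetLike.IsHomogeneousElem 𝒜 x → ∃ r : R, x = x * r * x

variable (R) in
/-- `R` has an identity element. -/
def IsUnital : Prop :=
  ∃ e : R, ∀ r : R, e * r = r ∧ r * e = r

/-- Descending chain condition on graded left ideals. -/
def IsGradedLeftArtinian (𝒜 : Γ → AddSubgroup R) : Prop :=
  IsGradedArtinianModule R 𝒜

/-- Descending chain condition on graded left ideals and on graded right ideals. -/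
def IsGradedArtinian (𝒜 : Γ → AddSubgroup R) : Prop :=
  IsGradedLeftArtinian 𝒜 ∧ IsGradedLeftArtinian (opGrading 𝒜)

/-- The corner ring `e R e`. -/
def corner (e : R) : NonUnitalSubring R where
  carrier := {y | ∃ r : R, y = e * r * e}
  add_mem' := by
    rintro _ _ ⟨r, rfl⟩ ⟨s, rfl⟩
    exact ⟨r + s, by rw [mul_add, add_mul]⟩
  zero_mem' := ⟨0, by simp⟩
  mul_mem' := by
    rintro _ _ ⟨r, rfl⟩ ⟨s, rfl⟩
    exact ⟨r * e * e * s, by simp only [mul_assoc]⟩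
  neg_mem' := by
    rintro _ ⟨r, rfl⟩
    exact ⟨-r, by simp⟩

/-- The components `e R e ∩ R_γ` of the corner ring. -/
def cornerGrading (𝒜 : Γ → AddSubgroup R) (e : R) (γ : Γ) : AddSubgroup (corner e) :=
  (𝒜 γ).comap (NonUnitalSubringClass.subtype (corner e) : corner e →+ R)

/-- For every finite set `F` of homogeneous elements there is a homogeneous idempotent `e` such
that `e R e` contains `F` and is a graded left artinian ring. -/
def IsGradedLocallyLeftArtinian (𝒜 : Γ → AddSubgroup R) : Prop :=
  ∀ F : Finset R, (∀ r ∈ F, SetLike.IsHomogeneousElem 𝒜 r) →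
    ∃ e : R, SetLike.IsHomogeneousElem 𝒜 e ∧ IsIdempotentElem e ∧ (∀ r ∈ F, r ∈ corner e) ∧
      IsGradedLeftArtinian (cornerGrading 𝒜 e)

/-- Graded locally artinian: on the left and on the right. -/
def IsGradedLocallyArtinian (𝒜 : Γ → AddSubgroup R) : Prop :=
  IsGradedLocallyLeftArtinian 𝒜 ∧ IsGradedLocallyLeftArtinian (opGrading 𝒜)

/-- Every finitely generated (unitary) graded left module is graded artinian. -/
def IsGradedCategoricallyLeftArtinian [DecidableEq Γ] (𝒜 : Γ → AddSubgroup R) : Prop :=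
  ∀ (M : Type w) [AddCommGroup M] [LeftModule R M] (ℳ : Γ → AddSubgroup M),
    IsGradedModule 𝒜 ℳ → IsUnitary R M → IsFinitelyGenerated R M → IsGradedArtinianModule R ℳ

/-- Graded categorically artinian: for left modules and for right modules. -/
def IsGradedCategoricallyArtinian [DecidableEq Γ] (𝒜 : Γ → AddSubgroup R) : Prop :=
  IsGradedCategoricallyLeftArtinian.{u, v, w} 𝒜 ∧
    IsGradedCategoricallyLeftArtinian.{u, v, w} (opGrading 𝒜)

end Rings

end GradedNonUnital

/-! Graded submodules of `M` are exactly the submodules over the subring of `End(M)` generated by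
the scalars and the projections onto components. Ordinary semisimple module theory therefore applies
to the lattice of graded submodules, and everything is phrased through the graded socle, the sum of
its atoms.

Statement 1. If `R` is its own left socle, then for a minimal graded left ideal `L` and homogeneous
`m` the module `Lm` is zero or minimal. So a unitary module `M = RM` is its own socle, and when
finitely generated it is artinian. For right modules the right socle must also be `R`: in a graded
semiprime ring `L = Re` with `eRe` a graded division ring (`exists_idempotent_of_isAtom`). That
condition is left-right symmetric, so `eR` is a minimal right ideal (`isAtom_leftPrincipal`), and
the right socle, being a two-sided ideal, contains `Re`.

Statements 2 and 3. Regularity gives semiprimeness. If graded left ideals inside `Re` satisfy the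
descending chain condition, idempotents generating minimal left ideals can be split off `e` until
nothing is left, so `e` lies in the socle (`IsGradedRegular.mem_gradedSocle`). In the unital case
take `e = 1`. In the local case the chain condition passes from `eRe` to `Re`, since by regularity a
graded left ideal in `Re` is determined by its trace on `eRe`. -/

namespace GradedNonUnital

/-! ### Graded submodules as submodules over a ring of endomorphisms -/

section GradedModules

variable {Γ : Type v} {R : Type u} {M : Type w} [DecidableEq Γ]
  [NonUnitalRing R] [AddCommGroup M]

/-- The projection onto the component of degree `γ`. -/
noncomputable def component {ℳ : Γ → AddSubgroup M} (h : DirectSum.IsInternal ℳ) (γ : Γ) :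
    M →+ M :=
  (ℳ γ).subtype.comp ((DFinsupp.evalAddMonoidHom γ).comp
    (AddEquiv.ofBijective (DirectSum.coeAddMonoidHom ℳ) h).symm.toAddMonoidHom)

section Component

variable {ℳ : Γ → AddSubgroup M} (h : DirectSum.IsInternal ℳ)
include h

theorem component_mem (γ : Γ) (m : M) : component h γ m ∈ ℳ γ := SetLike.coe_mem _

theorem component_apply (γ : Γ) (m : M) :
    component h γ m = (letI := h.chooseDecomposition; DirectSum.decompose ℳ m γ : M) := rfl

theorem component_of_mem {γ : Γ} {m : M} (hm : m ∈ ℳ γ) : component h γ m = m := by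
  let := h.chooseDecomposition
  rw [component_apply, DirectSum.decompose_of_mem_same ℳ hm]

theorem component_of_mem_of_ne {γ δ : Γ} {m : M} (hm : m ∈ ℳ γ) (hne : γ ≠ δ) :
    component h δ m = 0 := by
  let := h.chooseDecomposition
  rw [component_apply, DirectSum.decompose_of_mem_ne ℳ hm hne]

theorem sum_component (m : M) : ∃ s : Finset Γ, ∑ γ ∈ s, component h γ m = m := by
  classical
  let := h.chooseDecomposition
  exact ⟨_, DirectSum.sum_support_decompose ℳ m⟩

theorem mem_of_component_mem {N : AddSubgroup M} {m : M} (hm : ∀ γ, component h γ m ∈ N) :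
    m ∈ N := by
  obtain ⟨s, hs⟩ := sum_component h m
  rw [← hs]
  exact sum_mem fun γ _ => hm γ

theorem eq_top_of_forall_component_le {N : AddSubgroup M} (hN : ∀ γ, ℳ γ ≤ N) : N = ⊤ :=
  top_unique fun m _ => mem_of_component_mem h fun γ => hN γ (component_mem h γ m)

theorem exists_component_ne_zero {m : M} (hm : m ≠ 0) : ∃ γ, component h γ m ≠ 0 := by
  by_contra! hc
  exact hm (mem_of_component_mem (N := ⊥) h fun γ => by simp [hc])

theorem isHomogeneousSubgroup_iff (N : AddSubgroup M) :
    IsHomogeneousSubgroup ℳ N ↔ ∀ γ, ∀ m ∈ N, component h γ m ∈ N := by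
  constructor
  · intro hN γ
    have : N ≤ N.comap (component h γ) := by
      conv_lhs => rw [hN]
      refine iSup_le fun δ m hm => ?_
      rcases eq_or_ne δ γ with rfl | hne
      · simpa [AddSubgroup.mem_comap, component_of_mem h hm.2] using hm.1
      · simp [AddSubgroup.mem_comap, component_of_mem_of_ne h hm.2 hne]
    exact this
  · intro hN
    refine le_antisymm (fun m hm => mem_of_component_mem h fun γ => ?_)
      (iSup_le fun γ => inf_le_left)
    exact (le_iSup (fun γ => N ⊓ ℳ γ) γ) ⟨hN γ m hm, component_mem h γ m⟩

end Component

variable [LeftModule R M]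

/-- Multiplication by a ring element, as an additive endomorphism. -/
def smulHom (r : R) : M →+ M := AddMonoidHom.mk' (r • ·) (LeftModule.smul_add r)

/-- Scaling a fixed module element, as an additive map. -/
def smulRightHom (m : M) : R →+ M :=
  AddMonoidHom.mk' (fun r : R => r • m) fun r s => LeftModule.add_smul r s m

@[simp] theorem smulRightHom_apply (r : R) (m : M) : smulRightHom m r = r • m := rfl

/-- The ring of endomorphisms generated by the multiplications by ring elements and by the
projections onto the components. Its submodules are the graded submodules. -/
noncomputable def gradedActionRing (R : Type u) [NonUnitalRing R] [LeftModule R M]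
    {ℳ : Γ → AddSubgroup M} (h : DirectSum.IsInternal ℳ) : Subring (AddMonoid.End M) :=
  Subring.closure (Set.range (smulHom : R → M →+ M) ∪ Set.range (component h))

section Lattice

variable {ℳ : Γ → AddSubgroup M} (h : DirectSum.IsInternal ℳ)

theorem isGradedSubmodule_toAddSubgroup (P : Submodule (gradedActionRing R h) M) :
    IsGradedSubmodule R ℳ P.toAddSubgroup := by
  refine ⟨fun r m hm => ?_, (isHomogeneousSubgroup_iff h _).2 fun γ m hm => ?_⟩
  · exact P.smul_mem ⟨smulHom r, Subring.subset_closure (Or.inl ⟨r, rfl⟩)⟩ hm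
  · exact P.smul_mem ⟨component h γ, Subring.subset_closure (Or.inr ⟨γ, rfl⟩)⟩ hm

theorem smul_mem_of_mem (P : Submodule (gradedActionRing R h) M) (r : R) {m : M} (hm : m ∈ P) :
    r • m ∈ P :=
  (isGradedSubmodule_toAddSubgroup h P).1 r hm

theorem component_mem_of_mem (P : Submodule (gradedActionRing R h) M) (γ : Γ) {m : M}
    (hm : m ∈ P) : component h γ m ∈ P :=
  (isHomogeneousSubgroup_iff h _).1 (isGradedSubmodule_toAddSubgroup h P).2 γ m hm

/-- A graded submodule, as a submodule over the ring of graded actions. -/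
noncomputable def ofGraded {N : AddSubgroup M} (hN : IsGradedSubmodule R ℳ N) :
    Submodule (gradedActionRing R h) M where
  carrier := N
  add_mem' := N.add_mem
  zero_mem' := N.zero_mem
  smul_mem' := by
    rintro ⟨φ, hφ⟩ m hm
    have key : ∀ m ∈ N, φ m ∈ N := by
      induction hφ using Subring.closure_induction with
      | mem φ hφ =>
        rcases hφ with ⟨r, rfl⟩ | ⟨γ, rfl⟩
        · exact hN.1 r
        · exact (isHomogeneousSubgroup_iff h N).1 hN.2 γ
      | zero => exact fun m _ => N.zero_mem
      | one => exact fun m hm => hm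
      | add φ ψ _ _ h₁ h₂ => exact fun m hm => N.add_mem (h₁ m hm) (h₂ m hm)
      | neg φ _ h₁ => exact fun m hm => N.neg_mem (h₁ m hm)
      | mul φ ψ _ _ h₁ h₂ => exact fun m hm => h₁ _ (h₂ m hm)
    exact key m hm

@[simp] theorem mem_ofGraded {N : AddSubgroup M} (hN : IsGradedSubmodule R ℳ N) {m : M} :
    m ∈ ofGraded h hN ↔ m ∈ N := Iff.rfl

@[simp] theorem ofGraded_toAddSubgroup {N : AddSubgroup M} (hN : IsGradedSubmodule R ℳ N) :
    (ofGraded h hN).toAddSubgroup = N := rfl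

theorem isGradedArtinianModule_iff :
    IsGradedArtinianModule R ℳ ↔ IsArtinian (gradedActionRing R h) M := by
  rw [← monotone_stabilizes_iff_artinian]
  constructor
  · intro hA f
    obtain ⟨n, hn⟩ := hA (fun n => (OrderDual.ofDual (f n)).toAddSubgroup)
      (fun n => isGradedSubmodule_toAddSubgroup h _) fun i j hij => f.monotone hij
    exact ⟨n, fun m hm => Submodule.toAddSubgroup_injective (hn m hm).symm⟩
  · intro hA N hN hanti
    obtain ⟨n, hn⟩ := hA ⟨fun n => OrderDual.toDual (ofGraded h (hN n)),
      fun i j hij => hanti hij⟩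
    exact ⟨n, fun m hm => (congrArg
      (fun P => (OrderDual.ofDual P : Submodule (gradedActionRing R h) M).toAddSubgroup)
      (hn m hm)).symm⟩

variable (R) in
/-- The sum of the minimal graded submodules. -/
noncomputable def gradedSocle : Submodule (gradedActionRing R h) M :=
  sSup {P | IsAtom P}

theorem le_gradedSocle_of_isAtom {P : Submodule (gradedActionRing R h) M} (hP : IsAtom P) :
    P ≤ gradedSocle R h := le_sSup hP

theorem isAtom_ofGraded_iff {N : AddSubgroup M} (hN : IsGradedSubmodule R ℳ N) :
    IsAtom (ofGraded h hN) ↔ N ≠ ⊥ ∧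
      ∀ J : AddSubgroup M, IsGradedSubmodule R ℳ J → J ≤ N → J = ⊥ ∨ J = N := by
  have hbot : ∀ {J : AddSubgroup M} (hJ : IsGradedSubmodule R ℳ J),
      ofGraded h hJ = ⊥ ↔ J = ⊥ := by
    intro J hJ
    rw [← Submodule.toAddSubgroup_injective.eq_iff]
    rfl
  refine ⟨fun hA => ⟨fun h0 => hA.1 ((hbot hN).2 h0), fun J hJ hle => ?_⟩, fun hA =>
    ⟨fun h0 => hA.1 ((hbot hN).1 h0), fun Q hQ => ?_⟩⟩
  · rcases hA.le_iff.1 (show ofGraded h hJ ≤ ofGraded h hN from hle) with h0 | h0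
    · exact Or.inl ((hbot hJ).1 h0)
    · exact Or.inr (congrArg Submodule.toAddSubgroup h0)
  · rcases hA.2 Q.toAddSubgroup (isGradedSubmodule_toAddSubgroup h Q) hQ.le with h0 | h0
    · exact Submodule.toAddSubgroup_injective h0
    · exact absurd (Submodule.toAddSubgroup_injective
        (h0.trans (ofGraded_toAddSubgroup h hN).symm)) hQ.ne

end Lattice

end GradedModules

/-! ### The graded socle under the action of the ring -/

section GradedActions

variable {Γ : Type v} {R : Type u} {M : Type w} [AddCommGroup Γ] [DecidableEq Γ]
  [NonUnitalRing R] [AddCommGroup M] [LeftModule R M]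
  {𝒜 : Γ → AddSubgroup R} (h𝒜 : DirectSum.IsInternal 𝒜)
  {ℳ : Γ → AddSubgroup M} (hℳ : IsGradedModule 𝒜 ℳ)

theorem LeftModule.zero_smul (m : M) : (0 : R) • m = 0 := map_zero (smulRightHom (R := R) m)

theorem LeftModule.smul_zero (r : R) : r • (0 : M) = 0 := map_zero (smulHom (M := M) r)

include hℳ

/-- Both sides are additive in `r`, so homogeneous `r` suffice; there cancellation in `Γ` decides
which components vanish. -/
theorem component_smul_of_mem_right (γ : Γ) {δ : Γ} (r : R) {m : M} (hm : m ∈ ℳ δ) :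
    component hℳ.isInternal (γ + δ) (r • m) = component h𝒜 γ r • m := by
  have : ((component hℳ.isInternal (γ + δ)).comp (smulRightHom m)).eqLocus
      ((smulRightHom m).comp (component h𝒜 γ)) = ⊤ := by
    refine eq_top_of_forall_component_le h𝒜 fun α a ha => ?_
    change component hℳ.isInternal (γ + δ) (a • m) = component h𝒜 γ a • m
    rcases eq_or_ne α γ with rfl | hne
    · rw [component_of_mem _ (hℳ.smul_mem ha hm), component_of_mem _ ha]
    · rw [component_of_mem_of_ne _ (hℳ.smul_mem ha hm) (by simpa using hne),
        component_of_mem_of_ne _ ha hne, LeftModule.zero_smul]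
  exact (this ▸ AddSubgroup.mem_top r :)

theorem component_smul_of_mem_left {γ : Γ} (δ : Γ) {r : R} (hr : r ∈ 𝒜 γ) (m : M) :
    component hℳ.isInternal (γ + δ) (r • m) = r • component hℳ.isInternal δ m := by
  have : ((component hℳ.isInternal (γ + δ)).comp (smulHom r)).eqLocus
      ((smulHom r).comp (component hℳ.isInternal δ)) = ⊤ := by
    refine eq_top_of_forall_component_le hℳ.isInternal fun α a ha => ?_
    change component hℳ.isInternal (γ + δ) (r • a) = r • component hℳ.isInternal δ a
    rcases eq_or_ne α δ with rfl | hne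
    · rw [component_of_mem _ (hℳ.smul_mem hr ha), component_of_mem _ ha]
    · rw [component_of_mem_of_ne _ (hℳ.smul_mem hr ha) (by simpa using hne),
        component_of_mem_of_ne _ ha hne, LeftModule.smul_zero]
  exact (this ▸ AddSubgroup.mem_top m :)

include h𝒜 in
/-- Scaling a homogeneous element by the members of a graded left ideal. -/
theorem isGradedSubmodule_map_smulRightHom {L : AddSubgroup R} (hL : IsGradedLeftIdeal 𝒜 L)
    {δ : Γ} {m : M} (hm : m ∈ ℳ δ) : IsGradedSubmodule R ℳ (L.map (smulRightHom m)) := by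
  refine ⟨?_, (isHomogeneousSubgroup_iff hℳ.isInternal _).2 ?_⟩
  · rintro r _ ⟨x, hx, rfl⟩
    exact ⟨r * x, hL.1 r hx, LeftModule.mul_smul r x m⟩
  · rintro γ _ ⟨x, hx, rfl⟩
    refine ⟨component h𝒜 (γ - δ) x, (isHomogeneousSubgroup_iff h𝒜 L).1 hL.2 _ x hx, ?_⟩
    simp only [smulRightHom_apply]
    rw [← component_smul_of_mem_right h𝒜 hℳ _ x hm, sub_add_cancel]

include h𝒜 in
theorem isGradedSubmodule_comap_smulRightHom {N : AddSubgroup M} (hN : IsGradedSubmodule R ℳ N)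
    {δ : Γ} {m : M} (hm : m ∈ ℳ δ) : IsGradedLeftIdeal 𝒜 (N.comap (smulRightHom m)) := by
  refine ⟨?_, (isHomogeneousSubgroup_iff h𝒜 _).2 ?_⟩
  · intro r x hx
    change (r * x) • m ∈ N
    rw [LeftModule.mul_smul]
    exact hN.1 r hx
  · intro γ x hx
    change component h𝒜 γ x • m ∈ N
    rw [← component_smul_of_mem_right h𝒜 hℳ γ x hm]
    exact (isHomogeneousSubgroup_iff hℳ.isInternal N).1 hN.2 _ _ hx

omit hℳ [AddCommGroup Γ] in
include h𝒜 in
theorem IsGradedLeftIdeal.inf {I J : AddSubgroup R} (hI : IsGradedLeftIdeal 𝒜 I)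
    (hJ : IsGradedLeftIdeal 𝒜 J) : IsGradedLeftIdeal 𝒜 (I ⊓ J) :=
  isGradedSubmodule_toAddSubgroup h𝒜 (ofGraded h𝒜 hI ⊓ ofGraded h𝒜 hJ)

omit hℳ [AddCommGroup Γ] in
theorem isMinimalGradedLeftIdeal_of_isAtom {P : Submodule (gradedActionRing R h𝒜) R}
    (hP : IsAtom P) : IsMinimalGradedLeftIdeal 𝒜 P.toAddSubgroup :=
  ⟨isGradedSubmodule_toAddSubgroup h𝒜 P,
    (isAtom_ofGraded_iff h𝒜 (isGradedSubmodule_toAddSubgroup h𝒜 P)).1 hP⟩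

omit hℳ [AddCommGroup Γ] in
theorem mem_gradedSocle_of_mem_minimal {L : AddSubgroup R}
    (hL : IsMinimalGradedLeftIdeal 𝒜 L) {x : R} (hx : x ∈ L) : x ∈ gradedSocle R h𝒜 :=
  le_gradedSocle_of_isAtom h𝒜 ((isAtom_ofGraded_iff h𝒜 hL.1).2 hL.2) hx

/-- A graded submodule of `Lm` pulls back along `x ↦ xm` to a graded left ideal inside `L`, which is
`0` or `L`. Hence `Lm` is zero or minimal. -/
theorem smul_mem_gradedSocle_of_mem_minimal (h𝒜 : DirectSum.IsInternal 𝒜) {L : AddSubgroup R}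
    (hL : IsMinimalGradedLeftIdeal 𝒜 L) {δ : Γ} {m : M} (hm : m ∈ ℳ δ) {x : R} (hx : x ∈ L) :
    x • m ∈ gradedSocle R hℳ.isInternal := by
  have hLm := isGradedSubmodule_map_smulRightHom h𝒜 hℳ hL.1 hm
  by_cases h0 : L.map (smulRightHom m) = ⊥
  · have : x • m ∈ L.map (smulRightHom m) := ⟨x, hx, rfl⟩
    rw [h0, AddSubgroup.mem_bot] at this
    rw [this]
    exact zero_mem _
  · refine le_sSup (a := ofGraded hℳ.isInternal hLm) ?_ ⟨x, hx, rfl⟩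
    refine (isAtom_ofGraded_iff hℳ.isInternal hLm).2 ⟨h0, fun N hN hle => ?_⟩
    rcases hL.2.2 _ (hL.1.inf h𝒜 (isGradedSubmodule_comap_smulRightHom h𝒜 hℳ hN hm))
      inf_le_left with h1 | h1
    · left
      refine (AddSubgroup.eq_bot_iff_forall _).2 fun n hn => ?_
      obtain ⟨y, hy, rfl⟩ := hle hn
      have : y ∈ L ⊓ N.comap (smulRightHom m) := ⟨hy, hn⟩
      rw [h1, AddSubgroup.mem_bot] at this
      rw [this, map_zero]
    · right
      refine le_antisymm hle ?_
      rintro _ ⟨y, hy, rfl⟩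
      rw [← h1] at hy
      exact hy.2

/-- For `M = R` this makes the left socle a two-sided ideal. -/
theorem smul_mem_gradedSocle (h𝒜 : DirectSum.IsInternal 𝒜) {x : R}
    (hx : x ∈ gradedSocle R h𝒜) (m : M) : x • m ∈ gradedSocle R hℳ.isInternal := by
  have key : ∀ {δ : Γ} {m : M}, m ∈ ℳ δ → x • m ∈ gradedSocle R hℳ.isInternal := by
    intro δ m hm
    have : gradedSocle R h𝒜 ≤ ofGraded h𝒜 (isGradedSubmodule_comap_smulRightHom h𝒜 hℳ
        (isGradedSubmodule_toAddSubgroup hℳ.isInternal (gradedSocle R hℳ.isInternal)) hm) :=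
      sSup_le fun L hL y hy => smul_mem_gradedSocle_of_mem_minimal hℳ h𝒜
        (isMinimalGradedLeftIdeal_of_isAtom h𝒜 hL) hm hy
    exact this hx
  have : (gradedSocle R hℳ.isInternal).toAddSubgroup.comap (smulHom x) = ⊤ :=
    eq_top_of_forall_component_le hℳ.isInternal fun γ m hm => key hm
  exact (this ▸ AddSubgroup.mem_top m :)

omit hℳ in
theorem isGradedCategoricallyLeftArtinian_of_gradedSocle_eq_top (h𝒜 : DirectSum.IsInternal 𝒜)
    (htop : gradedSocle R h𝒜 = ⊤) :
    IsGradedCategoricallyLeftArtinian.{u, v, w} 𝒜 := by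
  intro M _ _ ℳ hℳ hunit ⟨s, hs⟩
  have hsoc : gradedSocle R hℳ.isInternal = ⊤ := by
    refine Submodule.toAddSubgroup_injective (top_unique ?_)
    change (⊤ : AddSubgroup M) ≤ _
    rw [← hunit, AddSubgroup.closure_le]
    rintro _ ⟨r, m, rfl⟩
    exact smul_mem_gradedSocle hℳ h𝒜 (htop ▸ Submodule.mem_top) m
  have hss : IsSemisimpleModule (gradedActionRing R hℳ.isInternal) M := by
    rw [← sSup_simples_eq_top_iff_isSemisimpleModule]
    simp only [isSimpleModule_iff_isAtom]
    exact hsoc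
  -- A span over the larger ring of actions is in particular an `R`-submodule, so the same
  -- generators, homogeneous or not, work.
  have hfin : Module.Finite (gradedActionRing R hℳ.isInternal) M := by
    refine ⟨s, Submodule.toAddSubgroup_injective ?_⟩
    exact hs _ (isGradedSubmodule_toAddSubgroup hℳ.isInternal _).1
      fun m hm => Submodule.subset_span hm
  exact (isGradedArtinianModule_iff hℳ.isInternal).2
    ((IsSemisimpleModule.finite_tfae.out 0 2).1 hfin)

end GradedActions

/-! ### Semiprime rings, idempotents and minimal graded left ideals -/

section GradedRings

variable {Γ : Type v} {R : Type u} [AddCommGroup Γ] [DecidableEq Γ] [NonUnitalRing R]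
  {𝒜 : Γ → AddSubgroup R}

theorem IsGradedRing.isGradedModule (h : IsGradedRing 𝒜) : IsGradedModule 𝒜 𝒜 :=
  ⟨h.isInternal, h.mul_mem⟩

/-- No nonzero homogeneous `y` satisfies `y R y = 0`. -/
def IsElementwiseSemiprime (𝒜 : Γ → AddSubgroup R) : Prop :=
  ∀ ⦃y : R⦄, SetLike.IsHomogeneousElem 𝒜 y → (∀ r, y * r * y = 0) → y = 0

variable (h : IsGradedRing 𝒜)
include h

theorem component_mul_of_mem_right (γ : Γ) {δ : Γ} (r : R) {m : R} (hm : m ∈ 𝒜 δ) :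
    component h.isInternal (γ + δ) (r * m) = component h.isInternal γ r * m :=
  component_smul_of_mem_right h.isInternal h.isGradedModule γ r hm

theorem component_mul_of_mem_left {γ : Γ} (δ : Γ) {r : R} (hr : r ∈ 𝒜 γ) (m : R) :
    component h.isInternal (γ + δ) (r * m) = r * component h.isInternal δ m :=
  component_smul_of_mem_left h.isGradedModule δ hr m

/-- The graded left ideal `R e` of a homogeneous element `e`. -/
noncomputable def leftPrincipal {δ : Γ} {e : R} (he : e ∈ 𝒜 δ) :
    Submodule (gradedActionRing R h.isInternal) R :=
  ofGraded h.isInternal (isGradedSubmodule_map_smulRightHom h.isInternal h.isGradedModule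
    (isGradedSubmodule_toAddSubgroup h.isInternal ⊤) he)

theorem mem_leftPrincipal {δ : Γ} {e : R} (he : e ∈ 𝒜 δ) {x : R} :
    x ∈ leftPrincipal h he ↔ ∃ r, r * e = x :=
  ⟨fun ⟨r, _, hr⟩ => ⟨r, hr⟩, fun ⟨r, hr⟩ => ⟨r, trivial, hr⟩⟩

theorem mul_mem_of_mem (P : Submodule (gradedActionRing R h.isInternal) R) (r : R) {x : R}
    (hx : x ∈ P) : r * x ∈ P := smul_mem_of_mem h.isInternal P r hx

theorem leftPrincipal_le {δ : Γ} {e : R} (he : e ∈ 𝒜 δ)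
    {P : Submodule (gradedActionRing R h.isInternal) R} (heP : e ∈ P) :
    leftPrincipal h he ≤ P := by
  intro x hx
  obtain ⟨r, rfl⟩ := (mem_leftPrincipal h he).1 hx
  exact mul_mem_of_mem h P r heP

theorem self_mem_leftPrincipal {δ : Γ} {e : R} (he : e ∈ 𝒜 δ) (hidem : e * e = e) :
    e ∈ leftPrincipal h he := (mem_leftPrincipal h he).2 ⟨e, hidem⟩

theorem mul_eq_of_mem_leftPrincipal {δ : Γ} {e : R} (he : e ∈ 𝒜 δ) (hidem : e * e = e) {x : R}
    (hx : x ∈ leftPrincipal h he) : x * e = x := by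
  obtain ⟨r, rfl⟩ := (mem_leftPrincipal h he).1 hx
  rw [mul_assoc, hidem]

theorem exists_homogeneous_ne_zero {P : Submodule (gradedActionRing R h.isInternal) R}
    (hP : P ≠ ⊥) : ∃ δ, ∃ x ∈ 𝒜 δ, x ∈ P ∧ x ≠ 0 := by
  obtain ⟨x, hx, hx0⟩ := P.ne_bot_iff.1 hP
  obtain ⟨γ, hγ⟩ := exists_component_ne_zero h.isInternal hx0
  exact ⟨γ, _, component_mem h.isInternal γ x, component_mem_of_mem h.isInternal P γ hx, hγ⟩

/-- The element has degree both `γ` and `γ + γ`, so it vanishes unless `γ = 0`. -/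
theorem idempotent_mem_zero {γ : Γ} {e : R} (he : e ∈ 𝒜 γ) (hidem : e * e = e) : e ∈ 𝒜 0 := by
  rcases eq_or_ne γ 0 with rfl | hγ
  · exact he
  · have h1 : e ∈ 𝒜 (γ + γ) := hidem ▸ h.mul_mem he he
    have h2 := component_of_mem_of_ne h.isInternal h1 (δ := γ) (by simpa using hγ)
    rw [component_of_mem h.isInternal he] at h2
    rw [h2]
    exact zero_mem _

/-- The degree-zero component of the identity is a left identity on homogeneous elements, hence on
`R`, hence equals the identity. -/
theorem one_mem_zero {e : R} (he : ∀ r : R, e * r = r ∧ r * e = r) : e ∈ 𝒜 0 := by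
  have key : (smulHom (component h.isInternal 0 e) : R →+ R).eqLocus (AddMonoidHom.id R) = ⊤ := by
    refine eq_top_of_forall_component_le h.isInternal fun γ r hr => ?_
    change component h.isInternal 0 e * r = r
    rw [← component_mul_of_mem_right h 0 e hr, (he r).1, zero_add,
      component_of_mem h.isInternal hr]
  have h1 : component h.isInternal 0 e * e = e := (key ▸ AddSubgroup.mem_top e :)
  rw [(he _).2] at h1
  rw [← h1]
  exact component_mem h.isInternal 0 e

/-- A homogeneous left multiple of a homogeneous element has a homogeneous cofactor. -/
theorem exists_homogeneous_mul_eq {γ δ : Γ} {x y r : R} (hx : x ∈ 𝒜 γ) (hy : y ∈ 𝒜 δ)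
    (hr : r * x = y) : ∃ s ∈ 𝒜 (δ - γ), s * x = y := by
  refine ⟨component h.isInternal (δ - γ) r, component_mem _ _ _, ?_⟩
  rw [← component_mul_of_mem_right h _ r hx, hr, sub_add_cancel, component_of_mem _ hy]

section Semiprime

/-- In a graded semiprime ring a graded left ideal of square zero vanishes. -/
theorem IsGradedSemiprime.eq_bot_of_mul_eq_zero (hsp : IsGradedSemiprime 𝒜)
    {L : Submodule (gradedActionRing R h.isInternal) R}
    (hL : ∀ a ∈ L, ∀ b ∈ L, a * b = 0) : L = ⊥ := by
  -- The two-sided ideal generated by `L` is `I = L + LR`. From `LL = 0` follow `LI = 0` and then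
  -- `II = 0`.
  have hI : ∀ a ∈ L, ∀ r, a * r ∈ L.toAddSubgroup ⊔ AddSubgroup.closure
      {y | ∃ a ∈ L, ∃ r, y = a * r} := fun a ha r =>
    le_sup_right (a := L.toAddSubgroup) (AddSubgroup.subset_closure ⟨a, ha, r, rfl⟩)
  set I : AddSubgroup R := L.toAddSubgroup ⊔ AddSubgroup.closure
      {y | ∃ a ∈ L, ∃ r, y = a * r} with hIdef
  have hLI : ∀ a ∈ L, a ∈ I := fun a ha => le_sup_left (a := L.toAddSubgroup) ha
  have hle : ∀ K : AddSubgroup R, (∀ a ∈ L, a ∈ K) → (∀ a ∈ L, ∀ r, a * r ∈ K) → I ≤ K := by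
    refine fun K h1 h2 => sup_le h1 ((AddSubgroup.closure_le _).2 ?_)
    rintro _ ⟨a, ha, r, rfl⟩
    exact h2 a ha r
  have hideal : IsGradedIdeal 𝒜 I := by
    refine ⟨fun r a ha => ⟨?_, ?_⟩, (isHomogeneousSubgroup_iff h.isInternal I).2 fun γ a ha => ?_⟩
    · refine hle (I.comap (AddMonoidHom.mulLeft r))
        (fun a ha => hLI _ (mul_mem_of_mem h L r ha)) (fun a ha s => ?_) ha
      change r * (a * s) ∈ I
      rw [← mul_assoc]
      exact hI _ (mul_mem_of_mem h L r ha) s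
    · refine hle (I.comap (AddMonoidHom.mulRight r)) (fun a ha => hI a ha r)
        (fun a ha s => ?_) ha
      change a * s * r ∈ I
      rw [mul_assoc]
      exact hI a ha _
    · refine hle (I.comap (component h.isInternal γ))
        (fun a ha => hLI _ (component_mem_of_mem h.isInternal L γ ha)) (fun a ha s => ?_) ha
      have htop : I.comap ((component h.isInternal γ).comp (AddMonoidHom.mulLeft a)) = ⊤ := by
        refine eq_top_of_forall_component_le h.isInternal fun δ r hr => ?_
        change component h.isInternal γ (a * r) ∈ I
        rw [← sub_add_cancel γ δ, component_mul_of_mem_right h _ a hr]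
        exact hI _ (component_mem_of_mem h.isInternal L _ ha) r
      exact (htop ▸ AddSubgroup.mem_top s :)
  have hmul : ∀ a ∈ L, ∀ b ∈ I, a * b = 0 := by
    intro a ha b hb
    refine hle (AddMonoidHom.mulLeft a).ker (fun b hb => hL a ha b hb) (fun b hb s => ?_) hb
    change a * (b * s) = 0
    rw [← mul_assoc, hL a ha b hb, zero_mul]
  have hsq : powSucc I 1 = ⊥ := by
    refine AddSubgroup.closure_eq_bot_iff.2 ?_
    rintro _ ⟨a, ha, b, hb, rfl⟩
    refine hle (AddMonoidHom.mulRight b).ker (fun a ha => hmul a ha b hb) (fun a ha s => ?_) ha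
    change a * s * b = 0
    rw [mul_assoc]
    exact hmul a ha _ (hideal.1 s hb).1
  have hbot := hsp I hideal ⟨1, hsq⟩
  refine (Submodule.eq_bot_iff _).2 fun a ha => ?_
  have := hLI a ha
  rwa [hbot, AddSubgroup.mem_bot] at this

/-- From `yRy = 0` the left ideal `Ry` has square zero, so `Ry = 0`. Without an identity this does
not yet give `y = 0`; but `y` now lies in `{m | Rm = 0}`, another graded left ideal of square zero.
-/
theorem IsGradedSemiprime.isElementwiseSemiprime (hsp : IsGradedSemiprime 𝒜) :
    IsElementwiseSemiprime 𝒜 := by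
  rintro y ⟨γ, hy⟩ hyy
  have h1 : leftPrincipal h hy = ⊥ := by
    refine hsp.eq_bot_of_mul_eq_zero h fun a ha b hb => ?_
    obtain ⟨r, rfl⟩ := (mem_leftPrincipal h hy).1 ha
    obtain ⟨s, rfl⟩ := (mem_leftPrincipal h hy).1 hb
    rw [mul_assoc, ← mul_assoc y, hyy, mul_zero]
  have hRy : ∀ r, r * y = 0 := fun r =>
    (Submodule.eq_bot_iff _).1 h1 _ ((mem_leftPrincipal h hy).2 ⟨r, rfl⟩)
  have hN : IsGradedSubmodule R 𝒜 (⨅ δ, ⨅ r : 𝒜 δ, (AddMonoidHom.mulLeft (r : R)).ker) := by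
    refine ⟨fun r m hm => ?_, (isHomogeneousSubgroup_iff h.isInternal _).2 fun γ m hm => ?_⟩
    all_goals
      simp only [AddSubgroup.mem_iInf, Subtype.forall, AddMonoidHom.mem_ker,
        AddMonoidHom.coe_mulLeft] at hm ⊢
      intro δ s hs
    · have htop : (AddMonoidHom.mulRight m).ker = ⊤ :=
        eq_top_of_forall_component_le h.isInternal fun δ s hs => hm δ s hs
      have hrm : r * m = 0 := (htop ▸ AddSubgroup.mem_top r :)
      change s * (r * m) = 0
      rw [hrm, mul_zero]
    · rw [← component_mul_of_mem_left h γ hs m, hm δ s hs, map_zero]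
  have h2 : ofGraded h.isInternal hN = ⊥ := by
    refine hsp.eq_bot_of_mul_eq_zero h fun a _ b hb => ?_
    have htop : (AddMonoidHom.mulRight b).ker = ⊤ := by
      refine eq_top_of_forall_component_le h.isInternal fun δ s hs => ?_
      simp only [mem_ofGraded, AddSubgroup.mem_iInf] at hb
      exact hb δ ⟨s, hs⟩
    exact (htop ▸ AddSubgroup.mem_top a :)
  refine (Submodule.eq_bot_iff _).1 h2 y ?_
  simp [AddMonoidHom.mem_ker, hRy]

omit h [AddCommGroup Γ] [DecidableEq Γ] in
theorem IsGradedRegular.isElementwiseSemiprime (hreg : IsGradedRegular 𝒜) :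
    IsElementwiseSemiprime 𝒜 := by
  intro y hy hyy
  obtain ⟨r, hr⟩ := hreg y hy
  rw [hr, hyy]

-- A homogeneous `x ∈ I` satisfies `x = x(rx)` with `rx ∈ I`, so it lies in every power of `I`.
omit h [AddCommGroup Γ] [DecidableEq Γ] in
theorem IsGradedRegular.isGradedSemiprime (hreg : IsGradedRegular 𝒜) :
    IsGradedSemiprime 𝒜 := by
  rintro I ⟨hI, hhom⟩ ⟨n, hn⟩
  rw [hhom]
  refine bot_unique (iSup_le fun γ x hx => ?_)
  rw [← hn]
  obtain ⟨r, hr⟩ := hreg x ⟨γ, hx.2⟩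
  clear hn
  induction n with
  | zero => exact hx.1
  | succ n ih =>
    exact AddSubgroup.subset_closure ⟨x, ih, r * x, (hI r hx.1).1, by rwa [← mul_assoc]⟩

end Semiprime

/-- If `e R e` is a graded division ring, then `R e` is a minimal graded left ideal. -/
theorem isAtom_leftPrincipal (hsp : IsElementwiseSemiprime 𝒜) {e : R} (he : e ∈ 𝒜 0)
    (hidem : e * e = e) (he0 : e ≠ 0)
    (hdiv : ∀ ⦃z⦄, SetLike.IsHomogeneousElem 𝒜 z → z ≠ 0 → e * z = z → z * e = z →
      ∃ w, w * z = e) : IsAtom (leftPrincipal h he) := by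
  refine ⟨fun h0 => he0 ((Submodule.eq_bot_iff _).1 h0 e (self_mem_leftPrincipal h he hidem)),
    fun Q hQ => ?_⟩
  by_contra hQ0
  obtain ⟨δ, y, hy, hyQ, hy0⟩ := exists_homogeneous_ne_zero h hQ0
  refine hQ.not_ge (leftPrincipal_le h he ?_)
  have hye := mul_eq_of_mem_leftPrincipal h he hidem (hQ.le hyQ)
  obtain ⟨r, hr⟩ : ∃ r, y * r * y ≠ 0 := by
    by_contra! hc
    exact hy0 (hsp ⟨δ, hy⟩ hc)
  obtain ⟨γ, hγ⟩ := exists_component_ne_zero h.isInternal hr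
  -- With `s` of this degree, `ysy` is the degree-`γ` component of `yry`.
  have hγ' : y * component h.isInternal (γ - δ - δ) r * y ≠ 0 := by
    rw [← component_mul_of_mem_left h _ hy, ← component_mul_of_mem_right h _ _ hy]
    convert hγ using 3
    abel
  set s := component h.isInternal (γ - δ - δ) r with hs
  have hsm : s ∈ 𝒜 (γ - δ - δ) := component_mem _ _ _
  -- Since `y = ye`, the element `esy` lies in `eRe`, and it is nonzero because `y(esy) = ysy`.
  -- Inverting it puts `e` in `Ry`.
  obtain ⟨w, hw⟩ := hdiv (z := e * (s * y)) ⟨_, h.mul_mem he (h.mul_mem hsm hy)⟩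
    (fun h0 => hγ' (by rw [← congrArg (· * s * y) hye]; simp only [mul_assoc, h0, mul_zero]))
    (by rw [← mul_assoc, hidem]) (by simp only [mul_assoc, hye])
  rw [← hw, ← mul_assoc, ← mul_assoc]
  exact mul_mem_of_mem h Q _ hyQ

/-- A minimal graded left ideal of a graded semiprime ring is generated by an idempotent `e`
of degree zero such that `e R e` is a graded division ring. -/
theorem exists_idempotent_of_isAtom (hsp : IsGradedSemiprime 𝒜)
    {L : Submodule (gradedActionRing R h.isInternal) R} (hL : IsAtom L) :
    ∃ e ∈ 𝒜 0, e ∈ L ∧ e * e = e ∧ e ≠ 0 ∧ (∀ y ∈ L, y * e = y) ∧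
      ∀ ⦃z⦄, SetLike.IsHomogeneousElem 𝒜 z → z ≠ 0 → e * z = z → z * e = z →
        ∃ w, z * w = e := by
  obtain ⟨a, ha, δ, b, hbδ, hb, hab⟩ : ∃ a ∈ L, ∃ δ, ∃ b ∈ 𝒜 δ, b ∈ L ∧ a * b ≠ 0 := by
    by_contra! hc
    refine hL.1 (hsp.eq_bot_of_mul_eq_zero h fun a ha b hb => ?_)
    exact mem_of_component_mem (N := (AddMonoidHom.mulLeft a).ker) h.isInternal fun γ =>
      hc a ha γ _ (component_mem _ _ _) (component_mem_of_mem h.isInternal L γ hb)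
  have hmem : ∀ {N : AddSubgroup R}, IsGradedLeftIdeal 𝒜 N → N ≤ L.toAddSubgroup →
      N = ⊥ ∨ N = L.toAddSubgroup := (isMinimalGradedLeftIdeal_of_isAtom h.isInternal hL).2.2 _
  have hLgr := isGradedSubmodule_toAddSubgroup h.isInternal L
  -- Minimality and `Lb ≠ 0` force `Lb = L`, which contains `b`. The degree-zero component of `e'`
  -- still fixes `b`.
  obtain ⟨e', he', he'b⟩ : ∃ e' ∈ L, e' * b = b := by
    have hb' : b ∈ L.toAddSubgroup := hb
    rcases hmem (isGradedSubmodule_map_smulRightHom h.isInternal h.isGradedModule hLgr hbδ)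
      (by rintro _ ⟨x, _, rfl⟩; exact mul_mem_of_mem h L x hb) with h0 | h0
    · exact absurd ((AddSubgroup.eq_bot_iff_forall _).1 h0 (a * b) ⟨a, ha, rfl⟩) hab
    · rw [← h0] at hb'
      exact hb'
  set e := component h.isInternal 0 e' with hedef
  have he : e ∈ 𝒜 0 := component_mem _ _ _
  have heL : e ∈ L := component_mem_of_mem _ _ _ he'
  have heb : e * b = b := by
    rw [hedef, ← component_mul_of_mem_right h 0 e' hbδ, he'b, zero_add, component_of_mem _ hbδ]
  have hb0 : b ≠ 0 := fun h0 => hab (by rw [h0, mul_zero])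
  -- The annihilator of `b` in `L` misses `e`, so it is zero; applied to `ye - y` this makes `e` a
  -- right identity of `L`.
  have hann : ∀ y ∈ L, y * b = 0 → y = 0 := by
    intro y hy hyb
    have hy' : y ∈ L.toAddSubgroup ⊓ (⊥ : AddSubgroup R).comap (smulRightHom b) := ⟨hy, hyb⟩
    rcases hmem (IsGradedLeftIdeal.inf h.isInternal hLgr
      (isGradedSubmodule_comap_smulRightHom h.isInternal h.isGradedModule
        (isGradedSubmodule_toAddSubgroup h.isInternal ⊥) hbδ)) inf_le_left with h0 | h0
    · exact (AddSubgroup.eq_bot_iff_forall _).1 h0 y hy'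
    · have heL' : e ∈ L.toAddSubgroup := heL
      rw [← h0] at heL'
      have : e * b = 0 := heL'.2
      exact absurd (heb.symm.trans this) hb0
  have hye : ∀ y ∈ L, y * e = y := fun y hy => sub_eq_zero.1 <|
    hann _ (sub_mem (mul_mem_of_mem h L y heL) hy) (by rw [sub_mul, mul_assoc, heb, sub_self])
  have hidem := hye e heL
  have he0 : e ≠ 0 := fun h0 => hb0 (by rw [← heb, h0, zero_mul])
  have hdiv : ∀ ⦃z⦄, SetLike.IsHomogeneousElem 𝒜 z → z ≠ 0 → e * z = z → z * e = z →
      ∃ w, SetLike.IsHomogeneousElem 𝒜 w ∧ e * w = w ∧ w * e = w ∧ w * z = e := by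
    rintro z ⟨γ, hz⟩ hz0 hez hze
    have hzL : z ∈ L := hze ▸ mul_mem_of_mem h L z heL
    have hzmem : z ∈ leftPrincipal h hz := (mem_leftPrincipal h hz).2 ⟨e, hez⟩
    rcases hL.le_iff.1 (leftPrincipal_le h hz hzL) with h0 | h0
    · exact absurd ((Submodule.eq_bot_iff _).1 h0 z hzmem) hz0
    · rw [← h0] at heL
      obtain ⟨r, hr⟩ := (mem_leftPrincipal h hz).1 heL
      obtain ⟨w, hw, hwz⟩ := exists_homogeneous_mul_eq h hz he hr
      refine ⟨e * w * e, ⟨_, h.mul_mem (h.mul_mem he hw) he⟩, ?_, ?_, ?_⟩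
      · rw [← mul_assoc, ← mul_assoc, hidem]
      · rw [mul_assoc, hidem]
      · rw [mul_assoc, hez, mul_assoc, hwz, hidem]
  -- The left inverse `w` of `z` has its own left inverse `v`, and `v = z`. The resulting right
  -- inverse of `z` becomes a left inverse in the opposite ring.
  refine ⟨e, he, heL, hidem, he0, hye, fun z hz hz0 hez hze => ?_⟩
  obtain ⟨w, hw, hew, hwe, hwz⟩ := hdiv hz hz0 hez hze
  obtain ⟨v, -, -, hve, hvw⟩ := hdiv hw (fun h0 => he0 (by rw [← hwz, h0, zero_mul])) hew hwe
  have hzv : z = v := by rw [← hez, ← hvw, mul_assoc, hwz, hve]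
  exact ⟨w, by rw [hzv, hvw]⟩

end GradedRings

/-! ### Passage to the opposite ring -/

section Opposite

variable {Γ : Type v} {R : Type u} [AddCommGroup Γ] [DecidableEq Γ] [NonUnitalRing R]
  {𝒜 : Γ → AddSubgroup R}

omit [AddCommGroup Γ] [DecidableEq Γ] in
theorem op_mem_opGrading {γ : Γ} {r : R} :
    MulOpposite.op r ∈ opGrading 𝒜 γ ↔ r ∈ 𝒜 γ := by
  constructor
  · rintro ⟨s, hs, hsr⟩
    rwa [← MulOpposite.op_injective hsr]
  · exact fun hr => ⟨r, hr, rfl⟩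

omit [AddCommGroup Γ] in
theorem isInternal_opGrading (h : DirectSum.IsInternal 𝒜) :
    DirectSum.IsInternal (opGrading 𝒜) := by
  let E : (DirectSum Γ fun γ => 𝒜 γ) ≃+ DirectSum Γ fun γ => opGrading 𝒜 γ :=
    DFinsupp.mapRange.addEquiv fun γ =>
      (MulOpposite.opAddEquiv : R ≃+ Rᵐᵒᵖ).addSubgroupMap (𝒜 γ)
  have hcomp : (DirectSum.coeAddMonoidHom (opGrading 𝒜)).comp E.toAddMonoidHom =
      (MulOpposite.opAddEquiv : R ≃+ Rᵐᵒᵖ).toAddMonoidHom.comp (DirectSum.coeAddMonoidHom 𝒜) := by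
    refine DirectSum.addHom_ext fun γ x => ?_
    have hE : E (DirectSum.of (fun γ => 𝒜 γ) γ x) = DirectSum.of (fun γ => opGrading 𝒜 γ) γ
        ((MulOpposite.opAddEquiv : R ≃+ Rᵐᵒᵖ).addSubgroupMap (𝒜 γ) x) :=
      DFinsupp.mapRange_single (hf := fun _ => map_zero _)
    rw [AddMonoidHom.comp_apply, AddMonoidHom.comp_apply]
    change DirectSum.coeAddMonoidHom (opGrading 𝒜) (E (DirectSum.of (fun γ => 𝒜 γ) γ x)) = _
    rw [hE, DirectSum.coeAddMonoidHom_of]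
    exact DirectSum.coeAddMonoidHom_of (opGrading 𝒜) γ _
  refine (Function.Bijective.of_comp_iff _ E.bijective).1 ?_
  have : ⇑(DirectSum.coeAddMonoidHom (opGrading 𝒜)) ∘ E =
      (MulOpposite.opAddEquiv : R ≃+ Rᵐᵒᵖ) ∘ DirectSum.coeAddMonoidHom 𝒜 :=
    congrArg DFunLike.coe hcomp
  rw [this]
  exact (MulOpposite.opAddEquiv : R ≃+ Rᵐᵒᵖ).bijective.comp h

theorem IsGradedRing.opGrading (h : IsGradedRing 𝒜) : IsGradedRing (opGrading 𝒜) := by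
  refine ⟨isInternal_opGrading h.isInternal, ?_⟩
  rintro γ δ _ _ ⟨r, hr, rfl⟩ ⟨s, hs, rfl⟩
  -- Reversing the product reverses the sum of degrees, so commutativity of `Γ` enters.
  exact ⟨s * r, add_comm δ γ ▸ h.mul_mem hs hr, rfl⟩

omit [AddCommGroup Γ] [DecidableEq Γ] in
theorem IsElementwiseSemiprime.opGrading (hsp : IsElementwiseSemiprime 𝒜) :
    IsElementwiseSemiprime (opGrading 𝒜) := by
  rintro _ ⟨γ, y, hy, rfl⟩ hyy
  refine congrArg MulOpposite.op (hsp ⟨γ, hy⟩ fun r => ?_)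
  have := congrArg MulOpposite.unop (hyy (MulOpposite.op r))
  simpa [mul_assoc] using this

/-- In a graded semiprime ring which is the sum of its minimal graded left ideals, the minimal
graded right ideals add up to the ring as well. -/
theorem gradedSocle_opGrading_eq_top (h : IsGradedRing 𝒜) (hsp : IsGradedSemiprime 𝒜)
    (htop : gradedSocle R h.isInternal = ⊤) :
    gradedSocle Rᵐᵒᵖ h.opGrading.isInternal = ⊤ := by
  set S := gradedSocle Rᵐᵒᵖ h.opGrading.isInternal with hS
  let N : AddSubgroup R := S.toAddSubgroup.comap (MulOpposite.opAddEquiv : R ≃+ Rᵐᵒᵖ).toAddMonoidHom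
  have hmul : ∀ x ∈ N, ∀ r, r * x ∈ N := fun x hx r =>
    smul_mem_gradedSocle h.opGrading.isGradedModule h.opGrading.isInternal hx (MulOpposite.op r)
  have hle : ∀ P : Submodule (gradedActionRing R h.isInternal) R, IsAtom P → ∀ x ∈ P, x ∈ N := by
    intro P hP x hx
    obtain ⟨e, he, -, hidem, he0, hye, hdiv⟩ := exists_idempotent_of_isAtom h hsp hP
    -- As `x = xe` and the right socle absorbs left multiplication, it is enough that `e` lies in
    -- the minimal right ideal `eR`.
    rw [← hye x hx]
    refine hmul e ?_ x
    have he' := op_mem_opGrading.2 he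
    have hidem' : MulOpposite.op e * MulOpposite.op e = MulOpposite.op e :=
      congrArg MulOpposite.op hidem
    refine le_gradedSocle_of_isAtom _ (isAtom_leftPrincipal h.opGrading
      (hsp.isElementwiseSemiprime h).opGrading
      he' hidem' (fun h0 => he0 (MulOpposite.op_injective h0)) ?_)
      (self_mem_leftPrincipal h.opGrading he' hidem')
    rintro _ ⟨γ, z, hz, rfl⟩ hz0 hez hze
    obtain ⟨w, hw⟩ := hdiv ⟨γ, hz⟩ (fun h0 => hz0 (congrArg MulOpposite.op h0))
      (MulOpposite.op_injective hze) (MulOpposite.op_injective hez)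
    exact ⟨MulOpposite.op w, congrArg MulOpposite.op hw⟩
  have hNgr : IsGradedSubmodule R 𝒜 N := by
    refine ⟨fun r x hx => hmul x hx r, le_antisymm (fun x hx => ?_) (iSup_le fun γ => inf_le_left)⟩
    refine mem_of_component_mem h.isInternal fun γ => ?_
    refine (le_iSup (fun γ => N ⊓ 𝒜 γ) γ) ⟨?_, component_mem _ _ _⟩
    have htop' : ∀ y : R, MulOpposite.op (component h.isInternal γ y) =
        component h.opGrading.isInternal γ (MulOpposite.op y) := by
      intro y
      have : ((MulOpposite.opAddEquiv : R ≃+ Rᵐᵒᵖ).toAddMonoidHom.comp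
          (component h.isInternal γ)).eqLocus ((component h.opGrading.isInternal γ).comp
          (MulOpposite.opAddEquiv : R ≃+ Rᵐᵒᵖ).toAddMonoidHom) = ⊤ := by
        refine eq_top_of_forall_component_le h.isInternal fun δ y hy => ?_
        change MulOpposite.op (component h.isInternal γ y) =
          component h.opGrading.isInternal γ (MulOpposite.op y)
        rcases eq_or_ne δ γ with rfl | hne
        · rw [component_of_mem _ hy, component_of_mem _ (op_mem_opGrading.2 hy)]
        · rw [component_of_mem_of_ne _ hy hne,
            component_of_mem_of_ne _ (op_mem_opGrading.2 hy) hne, MulOpposite.op_zero]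
      exact (this ▸ AddSubgroup.mem_top y :)
    change MulOpposite.op (component h.isInternal γ x) ∈ S
    rw [htop' x]
    exact component_mem_of_mem _ S γ hx
  have hsoc : gradedSocle R h.isInternal ≤ ofGraded h.isInternal hNgr :=
    sSup_le fun P hP x hx => hle P hP x hx
  rw [htop] at hsoc
  exact top_unique fun x _ => hsoc (x := MulOpposite.unop x) trivial

end Opposite

/-! ### Graded semisimplicity, regularity and chain conditions -/

section Semisimple

variable {Γ : Type v} {R : Type u} [AddCommGroup Γ] [DecidableEq Γ] [NonUnitalRing R]
  {𝒜 : Γ → AddSubgroup R}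

omit [AddCommGroup Γ] in
theorem sSup_toAddSubgroup (h : DirectSum.IsInternal 𝒜)
    (s : Set (Submodule (gradedActionRing R h) R)) :
    (sSup s).toAddSubgroup = sSup (Submodule.toAddSubgroup '' s) := by
  have hmem : ∀ P ∈ s, ∀ x ∈ P, x ∈ sSup (Submodule.toAddSubgroup '' s) := fun P hP x hx =>
    le_sSup (Set.mem_image_of_mem Submodule.toAddSubgroup hP) hx
  have hgr : IsGradedSubmodule R 𝒜 (sSup (Submodule.toAddSubgroup '' s)) := by
    refine ⟨fun r x hx => ?_, (isHomogeneousSubgroup_iff h _).2 fun γ x hx => ?_⟩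
    · have : sSup (Submodule.toAddSubgroup '' s) ≤
          (sSup (Submodule.toAddSubgroup '' s)).comap (smulHom r) := by
        refine sSup_le ?_
        rintro _ ⟨P, hP, rfl⟩ y hy
        exact hmem P hP _ (smul_mem_of_mem h P r hy)
      exact this hx
    · have : sSup (Submodule.toAddSubgroup '' s) ≤
          (sSup (Submodule.toAddSubgroup '' s)).comap (component h γ) := by
        refine sSup_le ?_
        rintro _ ⟨P, hP, rfl⟩ y hy
        exact hmem P hP _ (component_mem_of_mem h P γ hy)
      exact this hx
  refine le_antisymm ?_ (sSup_le ?_)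
  · have : sSup s ≤ ofGraded h hgr := sSup_le fun P hP x hx => hmem P hP x hx
    exact this
  · rintro _ ⟨P, hP, rfl⟩
    exact (le_sSup hP : P ≤ sSup s)

omit [AddCommGroup Γ] in
theorem isGradedSemisimple_of_gradedSocle_eq_top (h : DirectSum.IsInternal 𝒜)
    (hsp : IsGradedSemiprime 𝒜) (htop : gradedSocle R h = ⊤) : IsGradedSemisimple 𝒜 := by
  -- A complement of `⊥` is everything, so this yields an independent family of atoms with sum `R`.
  obtain ⟨s, hs, hcompl, hatom⟩ := exists_sSupIndep_isCompl_sSup_atoms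
    (α := Submodule (gradedActionRing R h) R) htop ⊥
  refine ⟨hsp, Submodule.toAddSubgroup '' s, ?_, ?_, ?_⟩
  · rintro _ ⟨P, hP, rfl⟩
    exact isMinimalGradedLeftIdeal_of_isAtom h (hatom hP)
  · rintro _ ⟨P, hP, rfl⟩
    have hdisj := hs hP
    rw [← Set.image_singleton, ← Set.image_sdiff Submodule.toAddSubgroup_injective,
      ← sSup_toAddSubgroup, AddSubgroup.disjoint_def]
    exact fun hx hy => Submodule.disjoint_def.1 hdisj _ hx hy
  · rw [← sSup_toAddSubgroup, eq_top_of_bot_isCompl hcompl]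
    rfl

omit [AddCommGroup Γ] in
theorem IsGradedSemisimple.gradedSocle_eq_top (h : DirectSum.IsInternal 𝒜)
    (hss : IsGradedSemisimple 𝒜) : gradedSocle R h = ⊤ := by
  obtain ⟨-, S, hS, -, htop⟩ := hss
  have : sSup S ≤ (gradedSocle R h).toAddSubgroup :=
    sSup_le fun L hL x hx => mem_gradedSocle_of_mem_minimal h (hS L hL) hx
  rw [htop] at this
  exact top_unique this

variable (h : IsGradedRing 𝒜)
include h

/-- In a graded regular ring every nonzero graded left ideal contains a nonzero idempotent of
degree zero. -/
theorem IsGradedRegular.exists_idempotent_mem (hreg : IsGradedRegular 𝒜)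
    {L : Submodule (gradedActionRing R h.isInternal) R} (hL : L ≠ ⊥) :
    ∃ g ∈ 𝒜 0, g ∈ L ∧ g * g = g ∧ g ≠ 0 := by
  obtain ⟨δ, x, hx, hxL, hx0⟩ := exists_homogeneous_ne_zero h hL
  obtain ⟨r, hr⟩ := hreg x ⟨δ, hx⟩
  -- In this degree `xsx` is the degree-`δ` component of `xrx = x`; hence `sx` is idempotent of
  -- degree zero.
  set s := component h.isInternal (-δ) r with hs
  have hsm : s ∈ 𝒜 (-δ) := component_mem _ _ _
  have hxs : x * (s * x) = x := by
    rw [hs, ← component_mul_of_mem_right h _ _ hx, ← component_mul_of_mem_left h _ hx,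
      neg_add_cancel, add_zero, ← mul_assoc, ← hr, component_of_mem _ hx]
  refine ⟨s * x, ?_, mul_mem_of_mem h L s hxL, ?_, ?_⟩
  · have := h.mul_mem hsm hx
    rwa [neg_add_cancel] at this
  · rw [mul_assoc, hxs]
  · intro h0
    rw [h0, mul_zero] at hxs
    exact hx0 hxs.symm

/-- Well-founded induction on `Rf`. Choose a minimal `L ≤ Rf` and an idempotent `g ∈ L`. Then `f =
(f - fg) + fg`, where `fg ∈ L` and `f - fg` is an idempotent generating a smaller left ideal. -/
theorem IsGradedRegular.mem_gradedSocle (hreg : IsGradedRegular 𝒜)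
    {P : Submodule (gradedActionRing R h.isInternal) R} [WellFoundedLT (Set.Iic P)]
    {e : R} (he : e ∈ 𝒜 0) (hidem : e * e = e) (heP : e ∈ P) :
    e ∈ gradedSocle R h.isInternal := by
  suffices H : ∀ Q : Set.Iic P, ∀ f (hf : f ∈ 𝒜 0), f * f = f → leftPrincipal h hf = Q →
      f ∈ gradedSocle R h.isInternal from
    H ⟨leftPrincipal h he, leftPrincipal_le h he heP⟩ e he hidem rfl
  intro Q
  induction Q using WellFoundedLT.induction with
  | ind Q ih =>
    intro f hf hff hfQ
    by_cases hQ : Q = ⊥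
    · have hfmem := self_mem_leftPrincipal h hf hff
      rw [hfQ, hQ] at hfmem
      have hf0 : f = 0 := (Submodule.mem_bot (gradedActionRing R h.isInternal)).1 hfmem
      rw [hf0]
      exact zero_mem _
    · have := isAtomic_of_orderBot_wellFounded_lt (wellFounded_lt (α := Set.Iic P))
      obtain ⟨L, hL, hLQ⟩ := (eq_bot_or_exists_atom_le Q).resolve_left hQ
      have hL' : IsAtom (L : Submodule (gradedActionRing R h.isInternal) R) :=
        hL.of_isAtom_coe_Iic
      have hLf : (L : Submodule (gradedActionRing R h.isInternal) R) ≤ leftPrincipal h hf :=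
        hfQ ▸ hLQ
      obtain ⟨g, hg, hgL, hgg, hg0⟩ := hreg.exists_idempotent_mem h hL'.1
      have hgf : g * f = g := mul_eq_of_mem_leftPrincipal h hf hff (hLf hgL)
      have hfgL : f * g ∈ (L : Submodule (gradedActionRing R h.isInternal) R) :=
        mul_mem_of_mem h _ f hgL
      have hf' : f - f * g ∈ 𝒜 0 := by
        have := h.mul_mem hf hg
        rw [zero_add] at this
        exact sub_mem hf this
      have hff' : (f - f * g) * (f - f * g) = f - f * g := by
        have h1 : f * g * f = f * g := by rw [mul_assoc, hgf]
        have h2 : f * (f * g) = f * g := by rw [← mul_assoc, hff]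
        have h3 : f * g * (f * g) = f * g := by rw [← mul_assoc, h1, mul_assoc, hgg]
        rw [sub_mul, mul_sub, mul_sub, hff, h1, h2, h3, sub_self, sub_zero]
      have hle : leftPrincipal h hf' ≤ leftPrincipal h hf := leftPrincipal_le h hf'
        (sub_mem (self_mem_leftPrincipal h hf hff) (hLf hfgL))
      -- Right multiplication by `g` kills `R(f - fg)` but not `f`, because `gfg = g ≠ 0`.
      have hnot : ¬ leftPrincipal h hf ≤ leftPrincipal h hf' := by
        intro hle'
        obtain ⟨r, hr⟩ := (mem_leftPrincipal h hf').1 (hle' (self_mem_leftPrincipal h hf hff))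
        have hfg : f * g = 0 := by
          rw [← hr, mul_assoc, sub_mul, mul_assoc, hgg, sub_self, mul_zero]
        have hgfg : g * f * g = g := by rw [hgf, hgg]
        rw [mul_assoc, hfg, mul_zero] at hgfg
        exact hg0 hgfg.symm
      have hQP : leftPrincipal h hf' ≤ P := hle.trans (hfQ ▸ Q.2)
      have hmem := ih ⟨leftPrincipal h hf', hQP⟩
        (lt_of_le_not_ge (show leftPrincipal h hf' ≤ Q from hfQ ▸ hle)
          (fun hc => hnot (show leftPrincipal h hf ≤ _ from hfQ ▸ hc))) _ hf' hff' rfl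
      have hsoc : f * g ∈ gradedSocle R h.isInternal :=
        le_gradedSocle_of_isAtom _ hL' hfgL
      have := add_mem hmem hsoc
      rwa [sub_add_cancel] at this

/-- In a graded regular ring, descending chains of graded left ideals inside `R e` stabilize if
those of the corner ring `e R e` do. -/
theorem IsGradedRegular.wellFoundedLT_Iic (hreg : IsGradedRegular 𝒜) {e : R} (he : e ∈ 𝒜 0)
    (hidem : e * e = e) (hart : IsGradedLeftArtinian (cornerGrading 𝒜 e)) :
    WellFoundedLT (Set.Iic (leftPrincipal h he)) := by
  let ι : corner e →+ R := (NonUnitalSubringClass.subtype (corner e) : corner e →+ R)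
  have hgr : ∀ I : Submodule (gradedActionRing R h.isInternal) R,
      IsGradedSubmodule (corner e) (cornerGrading 𝒜 e) (I.toAddSubgroup.comap ι) := by
    refine fun I => ⟨fun r x hx => mul_mem_of_mem h I (r : R) hx, le_antisymm (fun x hx => ?_)
      (iSup_le fun γ => inf_le_left)⟩
    obtain ⟨s, hs⟩ := sum_component h.isInternal (x : R)
    -- As `e` has degree zero, taking components commutes with `r ↦ ere`.
    have hcorner : ∀ γ, component h.isInternal γ (x : R) ∈ corner e := by
      intro γ
      obtain ⟨r, hr⟩ := x.2
      refine ⟨component h.isInternal γ r, ?_⟩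
      rw [hr, ← component_mul_of_mem_left h γ he, ← component_mul_of_mem_right h _ _ he,
        add_zero, zero_add]
    have hx' : x = ∑ γ ∈ s, (⟨_, hcorner γ⟩ : corner e) := by
      refine Subtype.ext ?_
      rw [AddSubmonoidClass.coe_finsetSum]
      exact hs.symm
    rw [hx']
    exact sum_mem fun γ _ => (le_iSup (fun γ => I.toAddSubgroup.comap ι ⊓ cornerGrading 𝒜 e γ) γ)
      ⟨component_mem_of_mem h.isInternal I γ hx, component_mem h.isInternal γ (x : R)⟩
  -- A homogeneous `y ∈ I` with `y = yry` and `ye = y` equals `y(ery)`, where `ery ∈ I ∩ eRe`. So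
  -- the trace on the corner determines `I`.
  have hle : ∀ I J : Submodule (gradedActionRing R h.isInternal) R, I ≤ leftPrincipal h he →
      I.toAddSubgroup.comap ι ≤ J.toAddSubgroup.comap ι → I ≤ J := by
    intro I J hI hIJ x hx
    refine mem_of_component_mem (N := J.toAddSubgroup) h.isInternal fun γ => ?_
    have hy := component_mem_of_mem h.isInternal I γ hx
    have hym := component_mem h.isInternal γ x
    set y := component h.isInternal γ x
    obtain ⟨r, hr⟩ := hreg y ⟨γ, hym⟩
    have hye := mul_eq_of_mem_leftPrincipal h he hidem (hI hy)
    have hmem : (⟨e * (r * y), r * y, by rw [mul_assoc, mul_assoc, hye]⟩ : corner e) ∈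
        I.toAddSubgroup.comap ι := mul_mem_of_mem h I e (mul_mem_of_mem h I r hy)
    have hJ : e * (r * y) ∈ J := hIJ hmem
    have hy' : y = y * (e * (r * y)) := by rw [← mul_assoc, hye, ← mul_assoc, ← hr]
    rw [hy']
    exact mul_mem_of_mem h J y hJ
  have : WellFoundedGT (Set.Iic (leftPrincipal h he))ᵒᵈ := by
    rw [wellFoundedGT_iff_monotone_chain_condition]
    intro f
    obtain ⟨n, hn⟩ := hart (fun n => (OrderDual.ofDual (f n)).1.toAddSubgroup.comap ι)
      (fun n => hgr _) fun i j hij x hx => f.monotone hij hx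
    exact ⟨n, fun m hm => Subtype.ext (le_antisymm
      (hle _ _ (OrderDual.ofDual (f n)).2 (hn m hm).ge)
      (hle _ _ (OrderDual.ofDual (f m)).2 (hn m hm).le))⟩
  exact ⟨this.wf⟩

theorem IsGradedRegular.isGradedSemisimple_of_unital (hreg : IsGradedRegular 𝒜)
    (hunit : IsUnital R) (hart : IsGradedLeftArtinian 𝒜) : IsGradedSemisimple 𝒜 := by
  obtain ⟨e, he⟩ := hunit
  have := (isGradedArtinianModule_iff h.isInternal).1 hart
  refine isGradedSemisimple_of_gradedSocle_eq_top h.isInternal hreg.isGradedSemiprime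
    (top_unique fun x _ => ?_)
  rw [← (he x).2]
  exact mul_mem_of_mem h _ x
    (hreg.mem_gradedSocle h (P := ⊤) (one_mem_zero h he) (he e).1 trivial)

theorem IsGradedRegular.isGradedSemisimple_of_locally (hreg : IsGradedRegular 𝒜)
    (hart : IsGradedLocallyLeftArtinian 𝒜) : IsGradedSemisimple 𝒜 := by
  refine isGradedSemisimple_of_gradedSocle_eq_top h.isInternal hreg.isGradedSemiprime
    (top_unique fun x _ => mem_of_component_mem
      (N := (gradedSocle R h.isInternal).toAddSubgroup) h.isInternal fun γ => ?_)
  have hym := component_mem h.isInternal γ x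
  set y := component h.isInternal γ x
  obtain ⟨e, ⟨δ, heδ⟩, hidem, hF, hcorner⟩ := hart {y} fun r hr =>
    ⟨γ, by rwa [Finset.mem_singleton.1 hr]⟩
  have he := idempotent_mem_zero h heδ hidem
  have := hreg.wellFoundedLT_Iic h he hidem hcorner
  obtain ⟨r, hr⟩ := hF y (Finset.mem_singleton_self y)
  rw [hr]
  exact mul_mem_of_mem h _ _
    (hreg.mem_gradedSocle h he hidem (self_mem_leftPrincipal h he hidem))

end Semisimple

end GradedNonUnital

theorem mainTheorem11 {Γ : Type v} {R : Type u} [AddCommGroup Γ] [DecidableEq Γ]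
    [NonUnitalRing R] (𝒜 : Γ → AddSubgroup R) (h𝒜 : GradedNonUnital.IsGradedRing 𝒜) :
    (GradedNonUnital.IsGradedSemisimple 𝒜 →
      GradedNonUnital.IsGradedCategoricallyArtinian.{u, v, w} 𝒜) ∧
    (GradedNonUnital.IsUnital R → GradedNonUnital.IsGradedRegular 𝒜 →
      GradedNonUnital.IsGradedArtinian 𝒜 → GradedNonUnital.IsGradedSemisimple 𝒜) ∧
    (GradedNonUnital.IsGradedRegular 𝒜 → GradedNonUnital.IsGradedLocallyArtinian 𝒜 →
      GradedNonUnital.IsGradedSemisimple 𝒜) := by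
  refine ⟨fun hss => ?_, fun hunit hreg hart => hreg.isGradedSemisimple_of_unital h𝒜 hunit hart.1,
    fun hreg hart => hreg.isGradedSemisimple_of_locally h𝒜 hart.1⟩
  have htop := hss.gradedSocle_eq_top h𝒜.isInternal
  exact ⟨GradedNonUnital.isGradedCategoricallyLeftArtinian_of_gradedSocle_eq_top h𝒜.isInternal htop,
    GradedNonUnital.isGradedCategoricallyLeftArtinian_of_gradedSocle_eq_top _
      (GradedNonUnital.gradedSocle_opGrading_eq_top h𝒜 hss.1 htop)⟩
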